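/- For positive integers $s_1,\dots,s_d$ with $s_1\ge 2$ let $$\zeta(s_1,\dots,s_d)=\sum_{k_1>\cdots>k_d>0}\frac{1}{k_1^{s_1}\cdots k_d^{s_d}}$$ denote the multiple zeta value. Then for every integer $n\ge 4$, $$\sum_{\substack{j\ge 2,\;k,l\ge 1\\ j+k+l=n}}(2j+k)\,\zeta(j,k,l)\;-\sum_{\substack{k\ge 2,\;l\ge 1\\ k+l=n-1}}k\,\zeta(k,1,l) =\zeta(2,n-2)+4\zeta(n)-(3n-5)\,\zeta(n-1,1).$$ -/

import Mathlib

/-- The multiple zeta value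
`ζ(s₁, …, s_d) = ∑_{k₁ > ⋯ > k_d > 0} 1 / (k₁ ^ s₁ ⋯ k_d ^ s_d)` of depth `d`.
The series has nonnegative terms; it converges whenever `s₁ ≥ 2` and all `sᵢ ≥ 1`. -/
noncomputable def multiZeta {d : ℕ} (s : Fin d → ℕ) : ℝ :=
  ∑' k : {k : Fin d → ℕ // StrictAnti k ∧ ∀ i, 0 < k i}, 1 / ∏ i, (k.1 i : ℝ) ^ s i

open scoped ENNReal

/-! The identity is a linear combination of known relations among multiple zeta values. Hoffman's
relation for `ζ(J+1, K+1)` (`hoffman_relation`), multiplied by `J + 1` and summed over `J + K = n -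
3` with `J ≥ 1`, puts weight `j + k - 1` on every `ζ(j,k,l)` and an additional `j` on those with `k
≥ 2`. Adding the sum formula `∑ ζ(j,k,l) = ζ(n)` (`sum_eZeta3`) turns this into `2j + k`, except
that the `j ζ(j,1,l)` are missing; they form the subtracted sum. On the right only double zeta
values remain, and Euler's formula `∑ ζ(a,b) = ζ(n)` (`sum_eZeta2`) and the two expansions of `ζ(2)
ζ(n-2)` (`shuffle_eq_stuffle`) evaluate their weighted sums.

The sum formulas come from connected sums in the style of Seki and Yamamoto. With a parameter `t`,
transport along `connector` proves the identities of generating functions `sum2_sub_eq_sum1` and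
`sum3_sub_eq_sum1`; expanding in powers of `t` and comparing coefficients gives all weights at once.
Hoffman's relation comes from evaluating one triple series in two ways by partial fractions.

All series live in `ℝ≥0∞`, where rearrangement is free; finiteness matters only for cancelling
terms, comparing coefficients and passing to `ℝ`. -/

/-! ### Rearrangement, telescoping and power series in `ℝ≥0∞`. -/

theorem ENNReal.tsum_sum_range (f : ℕ → ℕ → ℝ≥0∞) :
    ∑' n, ∑ i ∈ Finset.range n, f i n = ∑' i, ∑' x, f i (x + i + 1) := by
  have h1 : ∀ n, ∑ i ∈ Finset.range n, f i n = ∑' i, if i < n then f i n else 0 := by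
    intro n
    rw [tsum_eq_sum (s := Finset.range n) (by intro b hb; simp_all)]
    exact Finset.sum_congr rfl (fun i hi => by simp_all)
  simp_rw [h1]
  rw [ENNReal.tsum_comm]
  refine tsum_congr fun i => ?_
  rw [← Summable.sum_add_tsum_nat_add' (k := i + 1) (f := fun n => if i < n then f i n else 0)
    ENNReal.summable, Finset.sum_eq_zero, zero_add]
  · exact tsum_congr fun x => by rw [if_pos (by omega), add_assoc]
  · intro x hx
    rw [if_neg (by simp at hx; omega)]

theorem ENNReal.tsum_tsum_eq_tsum_antidiagonal (f : ℕ → ℕ → ℝ≥0∞) :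
    ∑' i, ∑' j, f i j = ∑' n, ∑ p ∈ Finset.HasAntidiagonal.antidiagonal n, f p.1 p.2 := by
  rw [← ENNReal.tsum_prod,
    ← Finset.HasAntidiagonal.sigmaAntidiagonalEquivProd.tsum_eq (fun p : ℕ × ℕ => f p.1 p.2), ENNReal.tsum_sigma']
  refine tsum_congr fun n => ?_
  rw [tsum_fintype]
  exact Finset.sum_coe_sort (Finset.HasAntidiagonal.antidiagonal n) (fun p : ℕ × ℕ => f p.1 p.2)

theorem ENNReal.tsum_tsum_trichotomy (f : ℕ → ℕ → ℝ≥0∞) :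
    ∑' z, ∑' y, f y z =
      (∑' z, ∑' y, f (y + z + 1) z) + (∑' z, ∑' y, f z (y + z + 1)) + ∑' z, f z z := by
  have h : ∀ z, ∑' y, f y z =
      (∑' y, f (y + z + 1) z) + (∑ y ∈ Finset.range z, f y z) + f z z := by
    intro z
    rw [← Summable.sum_add_tsum_nat_add' (k := z + 1) (f := fun y => f y z) ENNReal.summable,
      Finset.sum_range_succ, add_comm, ← add_assoc]
    rfl
  simp_rw [h, ENNReal.tsum_add, ENNReal.tsum_sum_range]

theorem ENNReal.tsum_ofReal_telescope {u : ℕ → ℝ} (hu : Antitone u)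
    (hl : Filter.Tendsto u Filter.atTop (nhds 0)) :
    ∑' x, ENNReal.ofReal (u x - u (x + 1)) = ENNReal.ofReal (u 0) := by
  have hn : ∀ x, 0 ≤ u x - u (x + 1) := fun x => sub_nonneg.2 (hu (Nat.le_succ x))
  have hs : HasSum (fun x => u x - u (x + 1)) (u 0) := by
    rw [hasSum_iff_tendsto_nat_of_nonneg hn]
    simp_rw [Finset.sum_range_sub']
    simpa using hl.const_sub (u 0)
  rw [← ENNReal.ofReal_tsum_of_nonneg hn hs.summable, hs.tsum_eq]

/-- Let `t → 0` in `a 0 ≤ ∑ tⁿ aₙ = ∑ tⁿ bₙ ≤ b 0 + t S`, where `S`, the tail of the second series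
at `r` divided by `r`, is finite. -/
theorem ENNReal.tsum_pow_mul_head_le {a b : ℕ → ℝ≥0∞} {r : ℝ} (hr : 0 < r)
    (h : ∀ t : ℝ, 0 < t → t ≤ r →
      ∑' n, ENNReal.ofReal t ^ n * a n = ∑' n, ENNReal.ofReal t ^ n * b n)
    (hb : ∑' n, ENNReal.ofReal r ^ n * b n ≠ ∞) : a 0 ≤ b 0 := by
  set S : ℝ≥0∞ := ∑' n, ENNReal.ofReal r ^ n * b (n + 1) with hS
  have hr0 : ENNReal.ofReal r ≠ 0 := by simpa using hr
  have hsplit : ∀ (c : ℕ → ℝ≥0∞) (t : ℝ≥0∞),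
      ∑' n, t ^ n * c n = c 0 + t * ∑' n, t ^ n * c (n + 1) := by
    intro c t
    rw [tsum_eq_zero_add' ENNReal.summable, ← ENNReal.tsum_mul_left]
    simp [pow_succ', mul_assoc]
  have hSfin : S ≠ ∞ := by
    rw [hsplit] at hb
    have := (ENNReal.add_ne_top.1 hb).2
    exact fun h => this (by rw [← hS, h, ENNReal.mul_top hr0])
  refine ENNReal.le_of_forall_pos_le_add fun ε hε _ => ?_
  obtain ⟨t, ht0, htr, hte⟩ : ∃ t : ℝ, 0 < t ∧ t ≤ r ∧ ENNReal.ofReal t * S ≤ ε := by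
    -- The `+ 1` keeps the denominator positive when `S = 0`.
    refine ⟨min r (ε / (S.toReal + 1)), by positivity, min_le_left _ _, ?_⟩
    have key : ∀ u : ℝ, 0 ≤ u → ENNReal.ofReal u * S = ENNReal.ofReal (u * S.toReal) := by
      intro u hu
      rw [ENNReal.ofReal_mul hu, ENNReal.ofReal_toReal hSfin]
    rw [key _ (by positivity), ← ENNReal.ofReal_coe_nnreal]
    apply ENNReal.ofReal_le_ofReal
    have h0 : 0 ≤ S.toReal := ENNReal.toReal_nonneg
    calc min r (ε / (S.toReal + 1)) * S.toReal ≤ ε / (S.toReal + 1) * S.toReal := by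
          gcongr; exact min_le_right _ _
      _ ≤ ε := by
          rw [div_mul_eq_mul_div, div_le_iff₀ (by positivity)]
          nlinarith [ε.2]
  calc a 0 ≤ ∑' n, ENNReal.ofReal t ^ n * a n := by rw [hsplit]; exact le_self_add
    _ = b 0 + ENNReal.ofReal t * ∑' n, ENNReal.ofReal t ^ n * b (n + 1) := by
      rw [h t ht0 htr, hsplit]
    _ ≤ b 0 + ENNReal.ofReal t * S := by
      gcongr
      rw [hS]
      gcongr
    _ ≤ b 0 + ε := by gcongr

/-- Power series with coefficients in `ℝ≥0∞` that agree and converge on `(0, r]` have the same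
coefficients. -/
theorem ENNReal.eq_of_tsum_pow_mul_eq {r : ℝ} (hr : 0 < r) (n : ℕ) :
    ∀ {a b : ℕ → ℝ≥0∞}, (∀ t : ℝ, 0 < t → t ≤ r →
      ∑' n, ENNReal.ofReal t ^ n * a n = ∑' n, ENNReal.ofReal t ^ n * b n) →
    ∑' n, ENNReal.ofReal r ^ n * b n ≠ ∞ → a n = b n := by
  have head : ∀ {a b : ℕ → ℝ≥0∞}, (∀ t : ℝ, 0 < t → t ≤ r →
      ∑' n, ENNReal.ofReal t ^ n * a n = ∑' n, ENNReal.ofReal t ^ n * b n) →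
      ∑' n, ENNReal.ofReal r ^ n * b n ≠ ∞ → a 0 = b 0 := fun h hb =>
    le_antisymm (tsum_pow_mul_head_le hr h hb)
      (tsum_pow_mul_head_le hr (fun t h0 h1 => (h t h0 h1).symm) (by rwa [h r hr le_rfl]))
  have hsplit : ∀ (c : ℕ → ℝ≥0∞) (t : ℝ≥0∞),
      ∑' n, t ^ n * c n = c 0 + t * ∑' n, t ^ n * c (n + 1) := by
    intro c t
    rw [tsum_eq_zero_add' ENNReal.summable, ← ENNReal.tsum_mul_left]
    simp [pow_succ', mul_assoc]
  induction n with
  | zero => exact head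
  | succ n ih =>
    intro a b h hb
    have h0 := head h hb
    have hb' := hb
    rw [hsplit] at hb'
    have hb0 := (ENNReal.add_ne_top.1 hb').1
    have hb1 := (ENNReal.add_ne_top.1 hb').2
    -- Once the finite constant terms are cancelled, dividing by `t > 0` shifts both sequences.
    refine ih (a := fun n => a (n + 1)) (b := fun n => b (n + 1)) (fun t ht0 htr => ?_) ?_
    · have := h t ht0 htr
      rw [hsplit, hsplit b, h0, ENNReal.add_right_inj hb0] at this
      exact (ENNReal.mul_right_inj (by simpa using ht0) ENNReal.ofReal_ne_top).1 this
    · exact fun h => hb1 (by rw [h, ENNReal.mul_top (by simpa using hr)])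

/-! ### Sums over strictly decreasing tuples, parametrized by their gaps. -/

/-- `∑_{k > 0} f k`, as an extended nonnegative real. -/
noncomputable def sum1 (f : ℕ → ℝ) : ℝ≥0∞ := ∑' z, ENNReal.ofReal (f (z + 1))

/-- `∑_{p > q > 0} f p q`, as an extended nonnegative real. -/
noncomputable def sum2 (f : ℕ → ℕ → ℝ) : ℝ≥0∞ :=
  ∑' z, ∑' y, ENNReal.ofReal (f (y + z + 2) (z + 1))

/-- `∑_{p > q > r > 0} f p q r`, as an extended nonnegative real. -/
noncomputable def sum3 (f : ℕ → ℕ → ℕ → ℝ) : ℝ≥0∞ :=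
  ∑' z, ∑' y, ∑' x, ENNReal.ofReal (f (x + y + z + 3) (y + z + 2) (z + 1))

theorem sum1_congr {f g : ℕ → ℝ} (h : ∀ p, 0 < p → f p = g p) : sum1 f = sum1 g :=
  tsum_congr fun _ => by rw [h _ (by omega)]

theorem sum2_congr {f g : ℕ → ℕ → ℝ} (h : ∀ p q, 0 < q → q < p → f p q = g p q) :
    sum2 f = sum2 g :=
  tsum_congr fun _ => tsum_congr fun _ => by rw [h _ _ (by omega) (by omega)]

theorem sum3_congr {f g : ℕ → ℕ → ℕ → ℝ}
    (h : ∀ p q r, 0 < r → r < q → q < p → f p q r = g p q r) : sum3 f = sum3 g :=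
  tsum_congr fun _ => tsum_congr fun _ => tsum_congr fun _ => by
    rw [h _ _ _ (by omega) (by omega) (by omega)]

theorem sum2_mono {f g : ℕ → ℕ → ℝ} (h : ∀ p q, 0 < q → q < p → f p q ≤ g p q) :
    sum2 f ≤ sum2 g :=
  ENNReal.tsum_le_tsum fun _ => ENNReal.tsum_le_tsum fun _ =>
    ENNReal.ofReal_le_ofReal (h _ _ (by omega) (by omega))

theorem sum3_mono {f g : ℕ → ℕ → ℕ → ℝ}
    (h : ∀ p q r, 0 < r → r < q → q < p → f p q r ≤ g p q r) : sum3 f ≤ sum3 g :=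
  ENNReal.tsum_le_tsum fun _ => ENNReal.tsum_le_tsum fun _ => ENNReal.tsum_le_tsum fun _ =>
    ENNReal.ofReal_le_ofReal (h _ _ _ (by omega) (by omega) (by omega))

theorem sum2_add {f g : ℕ → ℕ → ℝ} (hf : ∀ p q, 0 < q → q < p → 0 ≤ f p q)
    (hg : ∀ p q, 0 < q → q < p → 0 ≤ g p q) :
    sum2 (fun p q => f p q + g p q) = sum2 f + sum2 g := by
  simp only [sum2, ← ENNReal.tsum_add]
  exact tsum_congr fun _ => tsum_congr fun _ =>
    ENNReal.ofReal_add (hf _ _ (by omega) (by omega)) (hg _ _ (by omega) (by omega))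

theorem sum3_add {f g : ℕ → ℕ → ℕ → ℝ} (hf : ∀ p q r, 0 < r → r < q → q < p → 0 ≤ f p q r)
    (hg : ∀ p q r, 0 < r → r < q → q < p → 0 ≤ g p q r) :
    sum3 (fun p q r => f p q r + g p q r) = sum3 f + sum3 g := by
  simp only [sum3, ← ENNReal.tsum_add]
  exact tsum_congr fun _ => tsum_congr fun _ => tsum_congr fun _ =>
    ENNReal.ofReal_add (hf _ _ _ (by omega) (by omega) (by omega))
      (hg _ _ _ (by omega) (by omega) (by omega))

theorem sum2_const_mul {c : ℝ} (hc : 0 ≤ c) (f : ℕ → ℕ → ℝ) :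
    sum2 (fun p q => c * f p q) = ENNReal.ofReal c * sum2 f := by
  simp only [sum2, ← ENNReal.tsum_mul_left, ENNReal.ofReal_mul hc]

theorem sum3_const_mul {c : ℝ} (hc : 0 ≤ c) (f : ℕ → ℕ → ℕ → ℝ) :
    sum3 (fun p q r => c * f p q r) = ENNReal.ofReal c * sum3 f := by
  simp only [sum3, ← ENNReal.tsum_mul_left, ENNReal.ofReal_mul hc]

theorem sum1_const_mul {c : ℝ} (hc : 0 ≤ c) (f : ℕ → ℝ) :
    sum1 (fun p => c * f p) = ENNReal.ofReal c * sum1 f := by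
  simp only [sum1, ← ENNReal.tsum_mul_left, ENNReal.ofReal_mul hc]

theorem sum2_finsetSum {ι : Type*} (s : Finset ι) {f : ι → ℕ → ℕ → ℝ}
    (hf : ∀ i ∈ s, ∀ p q, 0 < q → q < p → 0 ≤ f i p q) :
    sum2 (fun p q => ∑ i ∈ s, f i p q) = ∑ i ∈ s, sum2 (f i) := by
  classical
  induction s using Finset.induction_on with
  | empty => simp [sum2]
  | insert i s hi ih =>
    simp only [Finset.sum_insert hi]
    rw [sum2_add (hf i (by simp))
      (fun p q h1 h2 => Finset.sum_nonneg fun j hj => hf j (by simp [hj]) p q h1 h2),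
      ih fun j hj => hf j (by simp [hj])]

theorem sum3_finsetSum {ι : Type*} (s : Finset ι) {f : ι → ℕ → ℕ → ℕ → ℝ}
    (hf : ∀ i ∈ s, ∀ p q r, 0 < r → r < q → q < p → 0 ≤ f i p q r) :
    sum3 (fun p q r => ∑ i ∈ s, f i p q r) = ∑ i ∈ s, sum3 (f i) := by
  classical
  induction s using Finset.induction_on with
  | empty => simp [sum3]
  | insert i s hi ih =>
    simp only [Finset.sum_insert hi]
    rw [sum3_add (hf i (by simp))
      (fun p q r h1 h2 h3 => Finset.sum_nonneg fun j hj => hf j (by simp [hj]) p q r h1 h2 h3),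
      ih fun j hj => hf j (by simp [hj])]

theorem sum1_tsum {f : ℕ → ℝ} {g : ℕ → ℕ → ℝ}
    (h : ∀ p, 0 < p → ENNReal.ofReal (f p) = ∑' i, ENNReal.ofReal (g i p)) :
    sum1 f = ∑' i, sum1 (g i) := by
  simp only [sum1]
  conv_rhs => rw [ENNReal.tsum_comm]
  exact tsum_congr fun z => h (z + 1) (by omega)

theorem sum2_tsum {f : ℕ → ℕ → ℝ} {g : ℕ → ℕ → ℕ → ℝ}
    (h : ∀ p q, 0 < q → q < p → ENNReal.ofReal (f p q) = ∑' i, ENNReal.ofReal (g i p q)) :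
    sum2 f = ∑' i, sum2 (g i) := by
  simp only [sum2]
  conv_rhs => rw [ENNReal.tsum_comm]
  refine tsum_congr fun z => ?_
  conv_rhs => rw [ENNReal.tsum_comm]
  exact tsum_congr fun y => h (y + z + 2) (z + 1) (by omega) (by omega)

theorem sum3_tsum {f : ℕ → ℕ → ℕ → ℝ} {g : ℕ → ℕ → ℕ → ℕ → ℝ}
    (h : ∀ p q r, 0 < r → r < q → q < p →
      ENNReal.ofReal (f p q r) = ∑' i, ENNReal.ofReal (g i p q r)) :
    sum3 f = ∑' i, sum3 (g i) := by
  simp only [sum3]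
  conv_rhs => rw [ENNReal.tsum_comm]
  refine tsum_congr fun z => ?_
  conv_rhs => rw [ENNReal.tsum_comm]
  refine tsum_congr fun y => ?_
  conv_rhs => rw [ENNReal.tsum_comm]
  exact tsum_congr fun x =>
    h (x + y + z + 3) (y + z + 2) (z + 1) (by omega) (by omega) (by omega)

theorem sum3_eq_sum2 {f : ℕ → ℕ → ℕ → ℝ} {g : ℕ → ℕ → ℝ}
    (h : ∀ q r, 0 < r → r < q →
      ∑' x, ENNReal.ofReal (f (x + q + 1) q r) = ENNReal.ofReal (g q r)) :
    sum3 f = sum2 g :=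
  tsum_congr fun z => tsum_congr fun y => (tsum_congr fun x => by
    rw [show x + y + z + 3 = x + (y + z + 2) + 1 by omega]).trans <| h (y + z + 2) (z + 1) (by omega) (by omega)

theorem sum2_eq_sum1 {f : ℕ → ℕ → ℝ} {g : ℕ → ℝ}
    (h : ∀ q, 0 < q → ∑' x, ENNReal.ofReal (f (x + q + 1) q) = ENNReal.ofReal (g q)) :
    sum2 f = sum1 g :=
  tsum_congr fun z => h (z + 1) (by omega)

/-- The involution `q ↦ p + r - q` exchanges the gaps `p - q` and `q - r`, which are independent
summation variables. -/
theorem sum3_reflect_middle (F : ℕ → ℕ → ℕ → ℝ) :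
    sum3 (fun p q r => F p r (p - q)) = sum3 (fun p q r => F p r (q - r)) := by
  refine tsum_congr fun z => ?_
  rw [ENNReal.tsum_comm]
  refine tsum_congr fun y => tsum_congr fun x => ?_
  beta_reduce
  congr 2 <;> omega

theorem sum3_reflect_last (F : ℕ → ℕ → ℕ → ℝ) :
    sum3 (fun p q r => F p q (q - r)) = sum3 F := by
  simp only [sum3]
  rw [ENNReal.tsum_comm]
  refine tsum_congr fun z => tsum_congr fun y => tsum_congr fun x => ?_
  congr 2 <;> omega

theorem sum2_reflect (F : ℕ → ℕ → ℝ) : sum2 (fun p q => F p (p - q)) = sum2 F := by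
  simp only [sum2]
  rw [ENNReal.tsum_comm]
  refine tsum_congr fun z => tsum_congr fun y => ?_
  congr 2 <;> omega

/-- As `p > q > 0` vary, `(p - q, q)` runs over all pairs of positive integers; these are split by
the order of their entries. Applied to a product, this compares shuffle with quasi-shuffle. -/
theorem sum2_trichotomy (F : ℕ → ℕ → ℝ) :
    sum2 (fun p q => F (p - q) q) = sum2 F + sum2 (fun p q => F q p) + sum1 (fun p => F p p) := by
  have h := ENNReal.tsum_tsum_trichotomy (fun y z => ENNReal.ofReal (F (y + 1) (z + 1)))
  have e : ∀ y z, y + z + 2 - (z + 1) = y + 1 := fun y z => by omega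
  simp only [sum2, sum1, e]
  exact h

theorem sum2_sum_Ioo {f : ℕ → ℕ → ℕ → ℝ} (hf : ∀ p q r, 0 < r → r < q → q < p → 0 ≤ f p q r) :
    sum2 (fun p r => ∑ q ∈ Finset.Ioo r p, f p q r) = sum3 f := by
  refine tsum_congr fun z => ?_
  have := ENNReal.tsum_sum_range
    (fun i n => ENNReal.ofReal (f (n + z + 2) (i + z + 2) (z + 1)))
  refine Eq.trans (tsum_congr fun y => ?_)
    (this.trans (tsum_congr fun i => tsum_congr fun x => ?_))
  · rw [← ENNReal.ofReal_sum_of_nonneg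
      (fun i hi => hf _ _ _ (by omega) (by omega) (by simp at hi; omega))]
    congr 1
    refine Finset.sum_nbij' (fun q => q - (z + 2)) (fun i => i + z + 2) ?_ ?_ ?_ ?_ ?_
    all_goals (intro a ha; simp at ha ⊢)
    all_goals first
      | omega
      | (congr 1; omega)
  · congr 2; omega

theorem sum2_sum_Ioo_zero {f : ℕ → ℕ → ℕ → ℝ}
    (hf : ∀ p q r, 0 < r → r < q → q < p → 0 ≤ f p q r) :
    sum2 (fun p q => ∑ r ∈ Finset.Ioo 0 q, f p q r) = sum3 f := by
  have := ENNReal.tsum_sum_range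
    (fun i n => ∑' y, ENNReal.ofReal (f (y + n + 2) (n + 1) (i + 1)))
  simp only [sum2, sum3]
  refine Eq.trans (tsum_congr fun z => ?_)
    (this.trans (tsum_congr fun z => tsum_congr fun y => tsum_congr fun x => ?_))
  · rw [← Summable.tsum_finsetSum (fun _ _ => ENNReal.summable)]
    refine tsum_congr fun y => ?_
    rw [← ENNReal.ofReal_sum_of_nonneg
      (fun i hi => hf _ _ _ (by omega) (by simp at hi; omega) (by omega))]
    congr 1
    refine Finset.sum_nbij' (fun q => q - 1) (fun i => i + 1) ?_ ?_ ?_ ?_ ?_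
    all_goals (intro a ha; simp at ha ⊢)
    all_goals first
      | omega
      | (congr 1; omega)
  · congr 2; omega

/-! ### Partial fractions and harmonic numbers. -/

theorem sum_range_inv_pow_mul_inv_pow {p x : ℝ} (hx : 0 < x) (hp : x < p) (K : ℕ) :
    ∑ i ∈ Finset.range K, 1 / (p ^ (i + 2) * x ^ (K - i)) + 1 / (p ^ (K + 1) * (p - x)) =
      1 / (p * x ^ K * (p - x)) := by
  have hp0 : 0 < p := hx.trans hp
  have hd : p - x ≠ 0 := (sub_pos.2 hp).ne'
  induction K with
  | zero => simp
  | succ K ih =>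
    have h : ∀ i ∈ Finset.range K, 1 / (p ^ (i + 2) * x ^ (K + 1 - i)) =
        1 / (p ^ (i + 2) * x ^ (K - i)) / x := by
      intro i hi
      rw [show K + 1 - i = (K - i) + 1 by simp at hi; omega, pow_succ x, ← mul_assoc,
        ← div_div]
    rw [Finset.sum_range_succ, Finset.sum_congr rfl h, ← Finset.sum_div, eq_sub_of_add_eq ih]
    simp only [Nat.add_sub_cancel_left, pow_one]
    field_simp
    ring

/-- Repeated use of `1/(mq) = (1/m + 1/q)/(m + q)`: this is the shuffle expansion of `ζ(2) ζ(s)`,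
term by term. -/
theorem one_div_sq_mul_pow_eq {m q : ℝ} (hm : 0 < m) (hq : 0 < q) (s : ℕ) :
    1 / (m ^ 2 * q ^ s) =
      ∑ i ∈ Finset.range s, ((i : ℝ) + 1) * (1 / ((m + q) ^ (i + 2) * q ^ (s - i))) +
        s * (1 / ((m + q) ^ (s + 1) * m)) + 1 / ((m + q) ^ s * m ^ 2) := by
  induction s with
  | zero => simp
  | succ s ih =>
    have h : ∀ i ∈ Finset.range s, ((i : ℝ) + 1) * (1 / ((m + q) ^ (i + 2) * q ^ (s + 1 - i))) =
        ((i : ℝ) + 1) * (1 / ((m + q) ^ (i + 2) * q ^ (s - i))) / q := by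
      intro i hi
      rw [show s + 1 - i = (s - i) + 1 by simp at hi; omega, pow_succ q, ← mul_assoc,
        ← div_div, mul_div_assoc]
    rw [Finset.sum_range_succ, Finset.sum_congr rfl h, ← Finset.sum_div,
      ← sub_eq_of_eq_add (sub_eq_of_eq_add ih)]
    simp only [Nat.add_sub_cancel_left, pow_one]
    push_cast
    field_simp
    ring

theorem hasSum_one_div_mul_add (q : ℕ) :
    HasSum (fun x : ℕ => 1 / ((x : ℝ) + 1) - 1 / ((x : ℝ) + q + 1))
      (∑ i ∈ Finset.Icc 1 q, 1 / (i : ℝ)) := by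
  induction q with
  | zero => simp
  | succ q ih =>
    have h : HasSum (fun x : ℕ => 1 / ((x : ℝ) + q + 1) - 1 / (((x + 1 : ℕ) : ℝ) + q + 1))
        (1 / ((q : ℝ) + 1)) := by
      rw [hasSum_iff_tendsto_nat_of_nonneg]
      · simp_rw [Finset.sum_range_sub' (fun x : ℕ => 1 / ((x : ℝ) + q + 1))]
        have hl := (tendsto_one_div_add_atTop_nhds_zero_nat (𝕜 := ℝ)).comp
          (Filter.tendsto_add_atTop_nat q)
        have := hl.const_sub (1 / ((0 : ℕ) + (q : ℝ) + 1))
        simpa using this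
      · intro x
        rw [sub_nonneg]
        apply one_div_le_one_div_of_le
        · positivity
        · push_cast; linarith
    rw [Finset.sum_Icc_succ_top (by omega)]
    convert ih.add h using 1
    · ext x; push_cast; ring
    · push_cast; ring

theorem tsum_ofReal_one_div_mul {q : ℕ} (hq : 0 < q) :
    ∑' x : ℕ, ENNReal.ofReal (1 / (((x + q + 1 : ℕ) : ℝ) * (((x + q + 1 : ℕ) : ℝ) - q))) =
      ENNReal.ofReal ((∑ i ∈ Finset.Icc 1 q, 1 / (i : ℝ)) / q) := by
  have hq' : (0 : ℝ) < q := by exact_mod_cast hq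
  have h := (hasSum_one_div_mul_add q).div_const (q : ℝ)
  have e : ∀ x : ℕ, (1 / ((x : ℝ) + 1) - 1 / ((x : ℝ) + q + 1)) / q =
      1 / (((x + q + 1 : ℕ) : ℝ) * (((x + q + 1 : ℕ) : ℝ) - q)) := by
    intro x
    push_cast
    have : (x : ℝ) + q + 1 - q ≠ 0 := by
      rw [show (x : ℝ) + q + 1 - q = x + 1 by ring]; positivity
    field_simp
    ring
  simp_rw [e] at h
  rw [← h.tsum_eq, ENNReal.ofReal_tsum_of_nonneg _ h.summable]
  intro x
  rw [← e]
  apply div_nonneg _ hq'.le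
  rw [sub_nonneg]
  apply one_div_le_one_div_of_le
  · positivity
  · linarith

/-! ### Connected sums. -/

/-- The multiple zeta value of depth one, as an extended nonnegative real. -/
noncomputable def eZeta1 (a : ℕ) : ℝ≥0∞ := sum1 fun p => 1 / (p : ℝ) ^ a

/-- The multiple zeta value of depth two, as an extended nonnegative real. -/
noncomputable def eZeta2 (a b : ℕ) : ℝ≥0∞ := sum2 fun p q => 1 / ((p : ℝ) ^ a * (q : ℝ) ^ b)

/-- The multiple zeta value of depth three, as an extended nonnegative real. -/
noncomputable def eZeta3 (a b c : ℕ) : ℝ≥0∞ :=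
  sum3 fun p q r => 1 / ((p : ℝ) ^ a * (q : ℝ) ^ b * (r : ℝ) ^ c)

/-- The connector of Seki and Yamamoto, deformed by `t`. -/
noncomputable def connector (t : ℝ) (m n : ℕ) : ℝ :=
  ∏ i ∈ Finset.range n, ((i : ℝ) + 1 - t) / ((m : ℝ) + i + 1 - t)

theorem connector_pos {t : ℝ} (ht : t < 1) (m n : ℕ) : 0 < connector t m n := by
  refine Finset.prod_pos fun i _ => ?_
  have : (0 : ℝ) ≤ i := by positivity
  have : (0 : ℝ) ≤ m := by positivity
  exact div_pos (by linarith) (by linarith)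

theorem connector_succ_right (t : ℝ) (m n : ℕ) :
    connector t m (n + 1) = connector t m n * (((n : ℝ) + 1 - t) / ((m : ℝ) + n + 1 - t)) := by
  rw [connector, Finset.prod_range_succ, connector]

theorem connector_zero_right (t : ℝ) (m : ℕ) : connector t m 0 = 1 := by simp [connector]

theorem connector_zero_left {t : ℝ} (ht : t < 1) (n : ℕ) : connector t 0 n = 1 := by
  refine Finset.prod_eq_one fun i _ => ?_
  have : (0 : ℝ) ≤ i := by positivity
  rw [Nat.cast_zero, zero_add, div_self (by linarith)]

theorem connector_succ_left {t : ℝ} (ht : t < 1) (m n : ℕ) :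
    connector t (m + 1) n * ((m : ℝ) + n + 1 - t) = connector t m n * ((m : ℝ) + 1 - t) := by
  have hm : (0 : ℝ) ≤ m := by positivity
  induction n with
  | zero => simp [connector_zero_right]
  | succ n ih =>
    have hn : (0 : ℝ) ≤ n := by positivity
    have h1 : (m : ℝ) + n + 1 - t ≠ 0 := by linarith
    have h2 : (m : ℝ) + 1 + n + 1 - t ≠ 0 := by linarith
    rw [connector_succ_right, connector_succ_right]
    push_cast
    rw [← sub_eq_zero] at ih ⊢
    field_simp
    linear_combination (n + 1 - t) * (m + 1 + n + 1 - t) * ih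

/-- This difference equation makes `connector t k n / (k - t)` telescope in `k`, which is what
`tsum_connector_left` sums. -/
theorem connector_sub_left {t : ℝ} (ht : t < 1) (m n : ℕ) :
    connector t m n - connector t (m + 1) n =
      connector t (m + 1) n * n / (((m + 1 : ℕ) : ℝ) - t) := by
  have hm : (0 : ℝ) ≤ m := by positivity
  have h1 : (m : ℝ) + 1 - t ≠ 0 := by linarith
  have := connector_succ_left ht m n
  push_cast
  field_simp
  linear_combination -this

/-- With `(x)ₖ` the rising factorial, the connector is `(1-t)ₘ (1-t)ₙ / (1-t)ₘ₊ₙ`. -/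
theorem connector_comm {t : ℝ} (ht : t < 1) (m n : ℕ) :
    connector t m n = connector t n m := by
  induction m with
  | zero => rw [connector_zero_left ht, connector_zero_right]
  | succ m ih =>
    have hm : (0 : ℝ) ≤ m := by positivity
    have hn : (0 : ℝ) ≤ n := by positivity
    have h1 : (m : ℝ) + n + 1 - t ≠ 0 := by linarith
    have h := connector_succ_left ht m n
    rw [connector_succ_right, ← ih]
    rw [show (n : ℝ) + m + 1 - t = m + n + 1 - t by ring]
    field_simp
    linear_combination h

theorem antitone_connector_left {t : ℝ} (ht : t < 1) (n : ℕ) :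
    Antitone fun m => connector t m n := by
  refine antitone_nat_of_succ_le fun m => ?_
  rw [← sub_nonneg, connector_sub_left ht]
  have hm : (0 : ℝ) ≤ m := by positivity
  have := connector_pos ht (m + 1) n
  refine div_nonneg (by positivity) ?_
  push_cast
  linarith

theorem tendsto_connector_left {t : ℝ} (ht : t < 1) {n : ℕ} (hn : 0 < n) :
    Filter.Tendsto (fun m => connector t m n) Filter.atTop (nhds 0) := by
  have hle : ∀ m, connector t m n ≤ (1 - t) * (1 / ((m : ℝ) + (1 - t))) := by
    intro m
    have hm : (0 : ℝ) ≤ m := by positivity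
    have h1 : connector t m 1 = (1 - t) * (1 / ((m : ℝ) + (1 - t))) := by
      rw [connector_succ_right, connector_zero_right]
      push_cast
      rw [show (m : ℝ) + 0 + 1 - t = m + (1 - t) by ring]
      ring
    rw [← h1, connector_comm ht, connector_comm ht m]
    exact antitone_connector_left ht m hn
  refine squeeze_zero (fun m => (connector_pos ht m n).le) hle ?_
  have h : Filter.Tendsto (fun m : ℕ => 1 / ((m : ℝ) + (1 - t))) Filter.atTop (nhds 0) := by
    simp_rw [one_div]
    exact Filter.Tendsto.inv_tendsto_atTop
      (Filter.tendsto_atTop_add_const_right _ _ tendsto_natCast_atTop_atTop)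
  simpa using h.const_mul (1 - t)

theorem tsum_connector_left {t : ℝ} (ht : t < 1) (m : ℕ) {n : ℕ} (hn : 0 < n) :
    ∑' x : ℕ, ENNReal.ofReal (connector t (x + m + 1) n / (((x + m + 1 : ℕ) : ℝ) - t)) =
      ENNReal.ofReal (connector t m n / n) := by
  have hn' : (0 : ℝ) < n := by exact_mod_cast hn
  have h := ENNReal.tsum_ofReal_telescope (u := fun x => connector t (x + m) n / n)
    (fun x y hxy => div_le_div_of_nonneg_right
      (antitone_connector_left ht n (Nat.add_le_add_right hxy m)) hn'.le)
    (by simpa using ((Filter.tendsto_add_atTop_iff_nat m).2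
      (tendsto_connector_left ht hn)).div_const (n : ℝ))
  simp only [zero_add] at h
  rw [← h]
  refine tsum_congr fun x => ?_
  rw [← sub_div, show x + 1 + m = x + m + 1 by ring, connector_sub_left ht]
  congr 1
  field_simp

theorem tsum_connector_right {t : ℝ} (ht : t < 1) {m : ℕ} (hm : 0 < m) :
    ∑' x : ℕ, ENNReal.ofReal (connector t m (x + 1) / (((x + 1 : ℕ) : ℝ) - t)) =
      ENNReal.ofReal (1 / m) := by
  have h := tsum_connector_left ht 0 hm
  rw [connector_zero_left ht] at h
  rw [← h]
  exact tsum_congr fun x => by rw [connector_comm ht, add_zero]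

/-- Replace `1/p` by `∑_b connector t p b / (b - t)` and interchange the sums. Summing over `p > q`
and then over `q > 0` yields a factor `1/b` each time, and `connector t 0 b = 1` ends the transport.
-/
theorem sum2_sub_eq_sum1 {t : ℝ} (ht : t < 1) :
    sum2 (fun p q => 1 / (p * ((p : ℝ) - t) * ((q : ℝ) - t))) =
      sum1 fun b => 1 / ((b : ℝ) ^ 2 * ((b : ℝ) - t)) := by
  have hk : ∀ {k : ℕ}, 0 < k → 0 < (k : ℝ) - t := fun {k} h => by
    have : (1 : ℝ) ≤ k := by exact_mod_cast h
    linarith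
  rw [sum2_tsum (g := fun b p q => 1 / (((p : ℝ) - t) * ((q : ℝ) - t)) *
    (connector t p (b + 1) / (((b + 1 : ℕ) : ℝ) - t)))]
  · refine tsum_congr fun b => ?_
    set n := b + 1 with hn
    have hn0 : 0 < n := by omega
    have hn' : (0 : ℝ) < n := by exact_mod_cast hn0
    rw [sum2_eq_sum1 (g := fun q => 1 / ((q : ℝ) - t) * (1 / (n * ((n : ℝ) - t))) *
      connector t q n)]
    · have := hk hn0
      have e : ∀ z : ℕ, 1 / (((z + 1 : ℕ) : ℝ) - t) * (1 / (n * ((n : ℝ) - t))) *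
          connector t (z + 1) n = 1 / (n * ((n : ℝ) - t)) *
            (connector t (z + 0 + 1) n / (((z + 0 + 1 : ℕ) : ℝ) - t)) := by
        intro z
        rw [add_zero]
        ring
      simp_rw [sum1, e, ENNReal.ofReal_mul (show (0 : ℝ) ≤ 1 / (n * ((n : ℝ) - t)) by positivity),
        ENNReal.tsum_mul_left]
      rw [tsum_connector_left ht 0 hn0, connector_zero_left ht,
        ← ENNReal.ofReal_mul (by positivity)]
      congr 1
      field_simp
    · intro q hq
      have := hk hq
      have := hk hn0
      have e : ∀ x : ℕ, 1 / ((((x + q + 1 : ℕ) : ℝ) - t) * ((q : ℝ) - t)) *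
          (connector t (x + q + 1) n / ((n : ℝ) - t)) =
          1 / (((q : ℝ) - t) * ((n : ℝ) - t)) *
            (connector t (x + q + 1) n / (((x + q + 1 : ℕ) : ℝ) - t)) := by
        intro x
        have := hk (show 0 < x + q + 1 by omega)
        field_simp
      simp_rw [e, ENNReal.ofReal_mul (show (0 : ℝ) ≤ 1 / (((q : ℝ) - t) * ((n : ℝ) - t)) by
        positivity), ENNReal.tsum_mul_left]
      rw [tsum_connector_left ht q hn0, ← ENNReal.ofReal_mul (by positivity)]
      congr 1
      field_simp
  · intro p q hq hqp
    have := hk hq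
    have := hk (hq.trans hqp)
    have hc : (0 : ℝ) ≤ 1 / (((p : ℝ) - t) * ((q : ℝ) - t)) := by positivity
    simp_rw [ENNReal.ofReal_mul hc, ENNReal.tsum_mul_left]
    rw [tsum_connector_right ht (hq.trans hqp), ← ENNReal.ofReal_mul hc]
    congr 1
    field_simp

theorem sum3_sub_eq_sum1 {t : ℝ} (ht : t < 1) :
    sum3 (fun p q r => 1 / (p * ((p : ℝ) - t) * ((q : ℝ) - t) * ((r : ℝ) - t))) =
      sum1 fun b => 1 / ((b : ℝ) ^ 3 * ((b : ℝ) - t)) := by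
  have hk : ∀ {k : ℕ}, 0 < k → 0 < (k : ℝ) - t := fun {k} h => by
    have : (1 : ℝ) ≤ k := by exact_mod_cast h
    linarith
  rw [sum3_tsum (g := fun b p q r => 1 / (((p : ℝ) - t) * ((q : ℝ) - t) * ((r : ℝ) - t)) *
    (connector t p (b + 1) / (((b + 1 : ℕ) : ℝ) - t)))]
  · refine tsum_congr fun b => ?_
    set n := b + 1 with hn
    have hn0 : 0 < n := by omega
    have hn' : (0 : ℝ) < n := by exact_mod_cast hn0
    have step : ∀ (q : ℕ) {C : ℝ}, 0 ≤ C → ∑' x : ℕ, ENNReal.ofReal (C *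
        (connector t (x + q + 1) n / (((x + q + 1 : ℕ) : ℝ) - t))) =
        ENNReal.ofReal (C * (connector t q n / n)) := by
      intro q C hC
      simp_rw [ENNReal.ofReal_mul hC, ENNReal.tsum_mul_left, tsum_connector_left ht q hn0]
    have hnt := hk hn0
    rw [sum3_eq_sum2 (g := fun q r => 1 / (((r : ℝ) - t) * ((n : ℝ) - t) * n) *
        (connector t q n / ((q : ℝ) - t))),
      sum2_eq_sum1 (g := fun r => 1 / (((n : ℝ) - t) * n ^ 2) *
        (connector t r n / ((r : ℝ) - t)))]
    · have := step 0 (C := 1 / (((n : ℝ) - t) * n ^ 2)) (by positivity)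
      simp only [add_zero] at this
      rw [sum1, this, connector_zero_left ht]
      congr 1
      field_simp
    · intro r hr
      have := hk hr
      rw [step r (by positivity)]
      congr 1
      field_simp
    · intro q r hr hq
      have h1 := hk hr
      have h2 := hk (hr.trans hq)
      rw [← show 1 / (((q : ℝ) - t) * ((r : ℝ) - t) * ((n : ℝ) - t)) * (connector t q n / n) =
        1 / (((r : ℝ) - t) * ((n : ℝ) - t) * n) * (connector t q n / ((q : ℝ) - t)) by field_simp,
        ← step q (by positivity)]
      refine tsum_congr fun x => ?_
      have := hk (show 0 < x + q + 1 by omega)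
      congr 1
      field_simp
  · intro p q r hr hq hp
    have := hk hr
    have := hk (hr.trans hq)
    have := hk ((hr.trans hq).trans hp)
    have hc : (0 : ℝ) ≤ 1 / (((p : ℝ) - t) * ((q : ℝ) - t) * ((r : ℝ) - t)) := by positivity
    simp_rw [ENNReal.ofReal_mul hc, ENNReal.tsum_mul_left]
    rw [tsum_connector_right ht ((hr.trans hq).trans hp), ← ENNReal.ofReal_mul hc]
    congr 1
    field_simp

/-! ### Finiteness and generating functions. -/

theorem eZeta1_ne_top {a : ℕ} (ha : 2 ≤ a) : eZeta1 a ≠ ∞ := by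
  have h := (summable_nat_add_iff 1).2 (Real.summable_one_div_nat_pow.2 (show 1 < a by omega))
  exact h.tsum_ofReal_ne_top

/-- The connected sum at `t = 0` is `ζ(2,1) = ζ(3)`, and `ζ(2,1)` dominates the series. In depth
three, `ζ(2,1,1) = ζ(4)` does the same. -/
theorem eZeta2_ne_top {a b : ℕ} (ha : 2 ≤ a) (hb : 1 ≤ b) : eZeta2 a b ≠ ∞ := by
  have h := sum2_sub_eq_sum1 (t := 0) (by norm_num)
  have h3 : sum1 (fun b => 1 / ((b : ℝ) ^ 2 * ((b : ℝ) - 0))) = eZeta1 3 :=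
    sum1_congr fun p _ => by rw [sub_zero]; ring
  rw [h3] at h
  refine ne_top_of_le_ne_top (h ▸ eZeta1_ne_top (by norm_num)) (sum2_mono fun p q hq hp => ?_)
  have hq1 : (1 : ℝ) ≤ q := by exact_mod_cast hq
  have hp1 : (1 : ℝ) ≤ p := by exact_mod_cast hq.trans hp
  rw [sub_zero, sub_zero]
  apply one_div_le_one_div_of_le (by positivity)
  calc (p : ℝ) * p * q = (p : ℝ) ^ 2 * (q : ℝ) ^ 1 := by ring
    _ ≤ (p : ℝ) ^ a * (q : ℝ) ^ b := by gcongr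

theorem eZeta3_ne_top {a b c : ℕ} (ha : 2 ≤ a) (hb : 1 ≤ b) (hc : 1 ≤ c) :
    eZeta3 a b c ≠ ∞ := by
  have h := sum3_sub_eq_sum1 (t := 0) (by norm_num)
  have h3 : sum1 (fun b => 1 / ((b : ℝ) ^ 3 * ((b : ℝ) - 0))) = eZeta1 4 :=
    sum1_congr fun p _ => by rw [sub_zero]; ring
  rw [h3] at h
  refine ne_top_of_le_ne_top (h ▸ eZeta1_ne_top (by norm_num)) (sum3_mono fun p q r hr hq hp => ?_)
  have hr1 : (1 : ℝ) ≤ r := by exact_mod_cast hr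
  have hq1 : (1 : ℝ) ≤ q := by exact_mod_cast hr.trans hq
  have hp1 : (1 : ℝ) ≤ p := by exact_mod_cast (hr.trans hq).trans hp
  simp only [sub_zero]
  apply one_div_le_one_div_of_le (by positivity)
  calc (p : ℝ) * p * q * r = (p : ℝ) ^ 2 * (q : ℝ) ^ 1 * (r : ℝ) ^ 1 := by ring
    _ ≤ (p : ℝ) ^ a * (q : ℝ) ^ b * (r : ℝ) ^ c := by gcongr

/-- The geometric series that expands each factor of the connected sums in powers of `t`. -/
theorem ofReal_mul_one_div_sub {C k t : ℝ} (hC : 0 ≤ C) (h0 : 0 ≤ t) (h : t < k) :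
    ENNReal.ofReal (C * (1 / (k - t))) =
      ∑' i : ℕ, ENNReal.ofReal (t ^ i * (C * (1 / k ^ (i + 1)))) := by
  have hk : 0 < k := h0.trans_lt h
  have hd : k - t ≠ 0 := (sub_pos.2 h).ne'
  have hs := (hasSum_geometric_of_lt_one (r := t / k) (by positivity)
    ((div_lt_one hk).2 h)).mul_left (C / k)
  have e : ∀ i : ℕ, C / k * (t / k) ^ i = t ^ i * (C * (1 / k ^ (i + 1))) := by
    intro i
    rw [div_pow]
    field_simp
    ring
  simp_rw [e] at hs
  rw [← ENNReal.ofReal_tsum_of_nonneg (fun i => by positivity) hs.summable, hs.tsum_eq]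
  congr 1
  have : 1 - t / k ≠ 0 := by rw [one_sub_div hk.ne']; exact div_ne_zero hd hk.ne'
  field_simp

theorem sum1_sub_eq_tsum {t : ℝ} (h0 : 0 ≤ t) (h1 : t < 1) (a : ℕ) :
    sum1 (fun b => 1 / ((b : ℝ) ^ a * ((b : ℝ) - t))) =
      ∑' n, ENNReal.ofReal t ^ n * eZeta1 (n + (a + 1)) := by
  rw [sum1_tsum (g := fun n p => t ^ n * (1 / (p : ℝ) ^ (n + (a + 1))))]
  · refine tsum_congr fun n => ?_
    rw [sum1_const_mul (by positivity), ENNReal.ofReal_pow h0, eZeta1]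
  · intro p hp
    have hp1 : (1 : ℝ) ≤ p := by exact_mod_cast hp
    rw [← one_div_mul_one_div, ofReal_mul_one_div_sub (by positivity) h0 (by linarith)]
    refine tsum_congr fun i => ?_
    congr 2
    rw [one_div_mul_one_div, ← pow_add]
    congr 2
    ring

theorem sum2_sub_eq_tsum {t : ℝ} (h0 : 0 ≤ t) (h1 : t < 1) :
    sum2 (fun p q => 1 / (p * ((p : ℝ) - t) * ((q : ℝ) - t))) =
      ∑' n, ENNReal.ofReal t ^ n *
        ∑ a ∈ Finset.HasAntidiagonal.antidiagonal n, eZeta2 (a.1 + 2) (a.2 + 1) := by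
  have hk : ∀ {k : ℕ}, 0 < k → t < (k : ℝ) := fun {k} h =>
    h1.trans_le (by exact_mod_cast h)
  have hk' : ∀ {k : ℕ}, 0 < k → 0 < (k : ℝ) - t := fun {k} h => sub_pos.2 (hk h)
  rw [sum2_tsum (g := fun i p q => t ^ i * (1 / (p * ((q : ℝ) - t)) * (1 / (p : ℝ) ^ (i + 1))))]
  · have : ∀ i, sum2 (fun p q =>
        t ^ i * (1 / (p * ((q : ℝ) - t)) * (1 / (p : ℝ) ^ (i + 1)))) =
        ∑' j, ENNReal.ofReal t ^ (i + j) * eZeta2 (i + 2) (j + 1) := by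
      intro i
      rw [sum2_tsum (g := fun j p q => t ^ (i + j) * (1 / ((p : ℝ) ^ (i + 2) * (q : ℝ) ^ (j + 1))))]
      · refine tsum_congr fun j => ?_
        rw [sum2_const_mul (by positivity), ENNReal.ofReal_pow h0, eZeta2]
      · intro p q hq hp
        have hp0 : (0 : ℝ) < p := by exact_mod_cast hq.trans hp
        have hq0 : (0 : ℝ) < q := by exact_mod_cast hq
        have := hk' hq
        rw [show t ^ i * (1 / (p * ((q : ℝ) - t)) * (1 / (p : ℝ) ^ (i + 1))) =
          (t ^ i * (1 / (p : ℝ) ^ (i + 2))) * (1 / ((q : ℝ) - t)) by field_simp; ring,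
          ofReal_mul_one_div_sub (by positivity) h0 (hk hq)]
        refine tsum_congr fun j => ?_
        congr 1
        field_simp
        ring
    simp_rw [this]
    rw [ENNReal.tsum_tsum_eq_tsum_antidiagonal
      (fun i j => ENNReal.ofReal t ^ (i + j) * eZeta2 (i + 2) (j + 1))]
    refine tsum_congr fun n => ?_
    rw [Finset.mul_sum]
    exact Finset.sum_congr rfl fun a ha => by rw [Finset.HasAntidiagonal.mem_antidiagonal.1 ha]
  · intro p q hq hp
    have := hk' hq
    have := hk' (hq.trans hp)
    have hp0 : (0 : ℝ) < p := by exact_mod_cast hq.trans hp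
    rw [← ofReal_mul_one_div_sub (by positivity) h0 (hk (hq.trans hp))]
    congr 1
    field_simp

theorem sum3_sub_eq_tsum {t : ℝ} (h0 : 0 ≤ t) (h1 : t < 1) :
    sum3 (fun p q r => 1 / (p * ((p : ℝ) - t) * ((q : ℝ) - t) * ((r : ℝ) - t))) =
      ∑' n, ENNReal.ofReal t ^ n *
        ∑ a ∈ Finset.HasAntidiagonal.antidiagonal n,
          ∑ b ∈ Finset.HasAntidiagonal.antidiagonal a.2,
            eZeta3 (a.1 + 2) (b.1 + 1) (b.2 + 1) := by
  have hk : ∀ {k : ℕ}, 0 < k → t < (k : ℝ) := fun {k} h =>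
    h1.trans_le (by exact_mod_cast h)
  have hk' : ∀ {k : ℕ}, 0 < k → 0 < (k : ℝ) - t := fun {k} h => sub_pos.2 (hk h)
  rw [sum3_tsum (g := fun i p q r =>
    t ^ i * (1 / (p * ((q : ℝ) - t) * ((r : ℝ) - t)) * (1 / (p : ℝ) ^ (i + 1))))]
  · have hi : ∀ i, sum3 (fun p q r =>
        t ^ i * (1 / (p * ((q : ℝ) - t) * ((r : ℝ) - t)) * (1 / (p : ℝ) ^ (i + 1)))) =
        ∑' s, ∑ b ∈ Finset.HasAntidiagonal.antidiagonal s,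
          ENNReal.ofReal t ^ (i + s) * eZeta3 (i + 2) (b.1 + 1) (b.2 + 1) := by
      intro i
      rw [sum3_tsum (g := fun j p q r =>
        t ^ j * ((t ^ i * (1 / ((p : ℝ) ^ (i + 2) * ((r : ℝ) - t)))) * (1 / (q : ℝ) ^ (j + 1))))]
      · have hj : ∀ j, sum3 (fun p q r =>
            t ^ j * ((t ^ i * (1 / ((p : ℝ) ^ (i + 2) * ((r : ℝ) - t)))) *
              (1 / (q : ℝ) ^ (j + 1)))) =
            ∑' l, ENNReal.ofReal t ^ (i + (j + l)) * eZeta3 (i + 2) (j + 1) (l + 1) := by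
          intro j
          rw [sum3_tsum (g := fun l p q r => t ^ (i + (j + l)) *
            (1 / ((p : ℝ) ^ (i + 2) * (q : ℝ) ^ (j + 1) * (r : ℝ) ^ (l + 1))))]
          · refine tsum_congr fun l => ?_
            rw [sum3_const_mul (by positivity), ENNReal.ofReal_pow h0, eZeta3]
          · intro p q r hr hq hp
            have := hk' hr
            have hr0 : (0 : ℝ) < r := by exact_mod_cast hr
            have hq0 : (0 : ℝ) < q := by exact_mod_cast hr.trans hq
            have hp0 : (0 : ℝ) < p := by exact_mod_cast (hr.trans hq).trans hp
            rw [show t ^ j * ((t ^ i * (1 / ((p : ℝ) ^ (i + 2) * ((r : ℝ) - t)))) *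
              (1 / (q : ℝ) ^ (j + 1))) =
              (t ^ (i + j) * (1 / ((p : ℝ) ^ (i + 2) * (q : ℝ) ^ (j + 1)))) *
                (1 / ((r : ℝ) - t)) by field_simp; ring,
              ofReal_mul_one_div_sub (by positivity) h0 (hk hr)]
            refine tsum_congr fun l => ?_
            congr 1
            field_simp
            ring
        simp_rw [hj]
        rw [ENNReal.tsum_tsum_eq_tsum_antidiagonal
          (fun j l => ENNReal.ofReal t ^ (i + (j + l)) * eZeta3 (i + 2) (j + 1) (l + 1))]
        refine tsum_congr fun s => ?_
        exact Finset.sum_congr rfl fun a ha => by rw [Finset.HasAntidiagonal.mem_antidiagonal.1 ha]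
      · intro p q r hr hq hp
        have := hk' hr
        have := hk' (hr.trans hq)
        have hp0 : (0 : ℝ) < p := by exact_mod_cast (hr.trans hq).trans hp
        rw [← ofReal_mul_one_div_sub (by positivity) h0 (hk (hr.trans hq))]
        congr 1
        field_simp
        ring
    simp_rw [hi]
    rw [ENNReal.tsum_tsum_eq_tsum_antidiagonal
      (fun i s => ∑ b ∈ Finset.HasAntidiagonal.antidiagonal s,
        ENNReal.ofReal t ^ (i + s) * eZeta3 (i + 2) (b.1 + 1) (b.2 + 1))]
    refine tsum_congr fun n => ?_
    rw [Finset.mul_sum]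
    refine Finset.sum_congr rfl fun a ha => ?_
    rw [Finset.mul_sum, Finset.HasAntidiagonal.mem_antidiagonal.1 ha]
  · intro p q r hr hq hp
    have := hk' hr
    have := hk' (hr.trans hq)
    have := hk' ((hr.trans hq).trans hp)
    have hp0 : (0 : ℝ) < p := by exact_mod_cast (hr.trans hq).trans hp
    rw [← ofReal_mul_one_div_sub (by positivity) h0 (hk ((hr.trans hq).trans hp))]
    congr 1
    field_simp

theorem tsum_pow_mul_eZeta1_ne_top {a : ℕ} (ha : 2 ≤ a) :
    ∑' n, ENNReal.ofReal (1 / 2) ^ n * eZeta1 (n + a) ≠ ∞ := by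
  refine ne_top_of_le_ne_top (b := (∑' n : ℕ, ENNReal.ofReal (1 / 2) ^ n) * eZeta1 a) ?_ ?_
  · refine ENNReal.mul_ne_top ?_ (eZeta1_ne_top ha)
    simp_rw [← ENNReal.ofReal_pow (show (0 : ℝ) ≤ 1 / 2 by norm_num)]
    exact (summable_geometric_of_lt_one (by norm_num) (by norm_num)).tsum_ofReal_ne_top
  · rw [← ENNReal.tsum_mul_right]
    refine ENNReal.tsum_le_tsum fun n => ?_
    gcongr
    refine ENNReal.tsum_le_tsum fun z => ENNReal.ofReal_le_ofReal ?_
    have : (1 : ℝ) ≤ (z + 1 : ℕ) := by exact_mod_cast Nat.succ_pos z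
    apply one_div_le_one_div_of_le (by positivity)
    exact pow_le_pow_right₀ this (by omega)

/-! ### Linear relations: sum formulas, Hoffman's relation, product of zeta values. -/

/-- Euler's sum formula for double zeta values. -/
theorem sum_eZeta2 (n : ℕ) :
    ∑ a ∈ Finset.HasAntidiagonal.antidiagonal n, eZeta2 (a.1 + 2) (a.2 + 1) = eZeta1 (n + 3) := by
  refine ENNReal.eq_of_tsum_pow_mul_eq (r := 1 / 2) (by norm_num) n
    (a := fun n => ∑ a ∈ Finset.HasAntidiagonal.antidiagonal n, eZeta2 (a.1 + 2) (a.2 + 1))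
    (b := fun n => eZeta1 (n + 3)) (fun t h0 h1 => ?_) (tsum_pow_mul_eZeta1_ne_top (by norm_num))
  rw [← sum2_sub_eq_tsum h0.le (by linarith), ← sum1_sub_eq_tsum h0.le (by linarith) 2,
    sum2_sub_eq_sum1 (by linarith)]

/-- The sum formula for triple zeta values. -/
theorem sum_eZeta3 (n : ℕ) :
    ∑ a ∈ Finset.HasAntidiagonal.antidiagonal n, ∑ b ∈ Finset.HasAntidiagonal.antidiagonal a.2,
      eZeta3 (a.1 + 2) (b.1 + 1) (b.2 + 1) = eZeta1 (n + 4) := by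
  refine ENNReal.eq_of_tsum_pow_mul_eq (r := 1 / 2) (by norm_num) n
    (a := fun n => ∑ a ∈ Finset.HasAntidiagonal.antidiagonal n,
      ∑ b ∈ Finset.HasAntidiagonal.antidiagonal a.2, eZeta3 (a.1 + 2) (b.1 + 1) (b.2 + 1))
    (b := fun n => eZeta1 (n + 4)) (fun t h0 h1 => ?_) (tsum_pow_mul_eZeta1_ne_top (by norm_num))
  rw [← sum3_sub_eq_tsum h0.le (by linarith), ← sum1_sub_eq_tsum h0.le (by linarith) 3,
    sum3_sub_eq_sum1 (by linarith)]

/-- The index `i ≤ p` of the harmonic number equals `p`, equals `q`, lies between them, or lies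
below `q`. -/
theorem sum2_mul_harmonic (j k : ℕ) :
    sum2 (fun p q => 1 / ((p : ℝ) ^ j * (q : ℝ) ^ k) * ∑ i ∈ Finset.Icc 1 p, 1 / (i : ℝ)) =
      eZeta2 (j + 1) k + eZeta2 j (k + 1) + (eZeta3 j 1 k + eZeta3 j k 1) := by
  have h : ∀ p q : ℕ, 0 < q → q < p →
      1 / ((p : ℝ) ^ j * (q : ℝ) ^ k) * ∑ i ∈ Finset.Icc 1 p, 1 / (i : ℝ) =
      (1 / ((p : ℝ) ^ (j + 1) * (q : ℝ) ^ k) + 1 / ((p : ℝ) ^ j * (q : ℝ) ^ (k + 1))) +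
      ((∑ i ∈ Finset.Ioo q p, 1 / ((p : ℝ) ^ j * (i : ℝ) ^ 1 * (q : ℝ) ^ k)) +
        ∑ i ∈ Finset.Ioo 0 q, 1 / ((p : ℝ) ^ j * (q : ℝ) ^ k * (i : ℝ) ^ 1)) := by
    intro p q hq hp
    have hu : Finset.Icc 1 p = insert p (insert q (Finset.Ioo q p ∪ Finset.Ioo 0 q)) := by
      ext i
      simp only [Finset.mem_Icc, Finset.mem_insert, Finset.mem_union, Finset.mem_Ioo]
      omega
    rw [hu, Finset.sum_insert (by simp; omega), Finset.sum_insert (by simp),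
      Finset.sum_union (Finset.disjoint_left.2 fun a ha hb => by
        simp only [Finset.mem_Ioo] at ha hb; omega)]
    have e1 : ∀ i : ℕ, 1 / ((p : ℝ) ^ j * (i : ℝ) ^ 1 * (q : ℝ) ^ k) =
        1 / ((p : ℝ) ^ j * (q : ℝ) ^ k) * (1 / i) := fun i => by
      rw [one_div_mul_one_div]; congr 1; ring
    have e2 : ∀ i : ℕ, 1 / ((p : ℝ) ^ j * (q : ℝ) ^ k * (i : ℝ) ^ 1) =
        1 / ((p : ℝ) ^ j * (q : ℝ) ^ k) * (1 / i) := fun i => by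
      rw [one_div_mul_one_div]; congr 1; ring
    simp_rw [e1, e2, ← Finset.mul_sum]
    have hp0 : (p : ℝ) ≠ 0 := by exact_mod_cast (hq.trans hp).ne'
    have hq0 : (q : ℝ) ≠ 0 := by exact_mod_cast hq.ne'
    field_simp
    ring
  rw [sum2_congr h, sum2_add, sum2_add, sum2_add, sum2_sum_Ioo
    (f := fun p i q => 1 / ((p : ℝ) ^ j * (i : ℝ) ^ 1 * (q : ℝ) ^ k)),
    sum2_sum_Ioo_zero (f := fun p q i => 1 / ((p : ℝ) ^ j * (q : ℝ) ^ k * (i : ℝ) ^ 1))]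
  · rfl
  all_goals intros; positivity

/-- Hoffman's relation for double zeta values. -/
theorem hoffman_relation {J : ℕ} (hJ : 1 ≤ J) (K : ℕ) :
    ∑ i ∈ Finset.range J, eZeta3 (i + 2) (J - i) (K + 1) +
      ∑ i ∈ Finset.range K, eZeta3 (J + 1) (i + 2) (K - i) =
    eZeta2 (J + 2) (K + 1) + eZeta2 (J + 1) (K + 2) := by
  -- `R` is the auxiliary series evaluated twice: `h1` uses partial fractions in `p, q`, and `h2`
  -- uses them in `q, r` after a reflection.
  set R := sum3 fun p q r => 1 / ((p : ℝ) ^ (J + 1) * (r : ℝ) ^ (K + 1) * ((p - q : ℕ) : ℝ))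
    with hR
  have cast : ∀ {p q : ℕ}, q < p → ((p - q : ℕ) : ℝ) = (p : ℝ) - q := fun h => by
    rw [Nat.cast_sub h.le]
  have h1 : ∑ i ∈ Finset.range J, eZeta3 (i + 2) (J - i) (K + 1) + R =
      sum2 (fun p q => 1 / ((p : ℝ) ^ (J + 1) * (q : ℝ) ^ (K + 1)) *
        ∑ i ∈ Finset.Icc 1 p, 1 / (i : ℝ)) := by
    simp only [eZeta3]
    rw [← sum3_finsetSum, hR, ← sum3_add]
    -- The partial fractions collapse to `1/(p (p - q))`, whose sum over `p > q` is the harmonic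
    -- number of `q` divided by `q`.
    · refine Eq.trans (sum3_congr (g := fun p q r => 1 / ((q : ℝ) ^ J * (r : ℝ) ^ (K + 1)) *
        (1 / (p * ((p : ℝ) - q)))) fun p q r hr hq hp => ?_) (sum3_eq_sum2 fun q r hr hq => ?_)
      · have hq0 : (0 : ℝ) < q := by exact_mod_cast hr.trans hq
        have hr0 : (0 : ℝ) < r := by exact_mod_cast hr
        have hpq : (q : ℝ) < p := by exact_mod_cast hp
        have := sum_range_inv_pow_mul_inv_pow hq0 hpq J
        have hd : (p : ℝ) - q ≠ 0 := (sub_pos.2 hpq).ne'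
        have hp0 : (p : ℝ) ≠ 0 := (hq0.trans hpq).ne'
        rw [cast hp]
        simp_rw [← one_div_mul_one_div _ ((r : ℝ) ^ (K + 1)), ← Finset.sum_mul]
        rw [eq_sub_of_add_eq this]
        field_simp
        ring
      · have hq0 : (0 : ℝ) < q := by exact_mod_cast hr.trans hq
        have hr0 : (0 : ℝ) < r := by exact_mod_cast hr
        have hc : (0 : ℝ) ≤ 1 / ((q : ℝ) ^ J * (r : ℝ) ^ (K + 1)) := by positivity
        simp_rw [ENNReal.ofReal_mul hc, ENNReal.tsum_mul_left]
        rw [tsum_ofReal_one_div_mul (hr.trans hq), ← ENNReal.ofReal_mul hc]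
        congr 1
        field_simp
        ring
    all_goals intros; positivity
  have h2 : ∑ i ∈ Finset.range K, eZeta3 (J + 1) (i + 2) (K - i) +
      (eZeta3 (J + 1) 1 (K + 1) + eZeta3 (J + 1) (K + 1) 1) = R := by
    rw [hR, sum3_reflect_middle
      (fun p r x => 1 / ((p : ℝ) ^ (J + 1) * (r : ℝ) ^ (K + 1) * (x : ℝ)))]
    -- The partial fraction of `1/(r^(K+1) (q - r))` leaves the remainder `1/(q^(K+1) (q - r))`;
    -- reflecting `r ↦ q - r` identifies its sum with `ζ(J+1, K+1, 1)`.
    rw [show eZeta3 (J + 1) (K + 1) 1 = _ from (sum3_reflect_last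
      (fun p q x => 1 / ((p : ℝ) ^ (J + 1) * (q : ℝ) ^ (K + 1) * (x : ℝ) ^ 1))).symm]
    simp only [eZeta3]
    rw [← sum3_finsetSum, ← sum3_add, ← sum3_add]
    · refine sum3_congr fun p q r hr hq hp => ?_
      have hr0 : (0 : ℝ) < r := by exact_mod_cast hr
      have hqr : (r : ℝ) < q := by exact_mod_cast hq
      have hq0 : (0 : ℝ) < q := hr0.trans hqr
      have hp0 : (0 : ℝ) < p := by exact_mod_cast (hr.trans hq).trans hp
      have := sum_range_inv_pow_mul_inv_pow hr0 hqr K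
      have hd : (q : ℝ) - r ≠ 0 := (sub_pos.2 hqr).ne'
      rw [cast hq]
      simp_rw [mul_assoc, ← one_div_mul_one_div ((p : ℝ) ^ (J + 1)), ← Finset.mul_sum]
      rw [eq_sub_of_add_eq this]
      field_simp
      ring
    all_goals intros; positivity
  rw [sum2_mul_harmonic, ← h2, ← add_assoc] at h1
  -- `ζ(J+1, 1, K+1)` and `ζ(J+1, K+1, 1)` occur on both sides; `J ≥ 1` makes them finite.
  exact (ENNReal.add_left_inj (ENNReal.add_ne_top.2
    ⟨eZeta3_ne_top (by omega) (by omega) (by omega),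
      eZeta3_ne_top (by omega) (by omega) (by omega)⟩)).1 h1

/-- The product of `ζ 2` and `ζ s`, expanded as a shuffle and as a quasi-shuffle. -/
theorem shuffle_eq_stuffle {s : ℕ} (hs : 2 ≤ s) :
    ∑ i ∈ Finset.range s, ENNReal.ofReal ((i : ℝ) + 1) * eZeta2 (i + 2) (s - i) +
      ENNReal.ofReal s * eZeta2 (s + 1) 1 = eZeta2 2 s + eZeta1 (s + 2) := by
  have hst := sum2_trichotomy fun m q => 1 / ((m : ℝ) ^ 2 * (q : ℝ) ^ s)
  have hsh : sum2 (fun p q => 1 / (((p - q : ℕ) : ℝ) ^ 2 * (q : ℝ) ^ s)) =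
      ∑ i ∈ Finset.range s, ENNReal.ofReal ((i : ℝ) + 1) * eZeta2 (i + 2) (s - i) +
      ENNReal.ofReal s * eZeta2 (s + 1) 1 + eZeta2 s 2 := by
    simp only [eZeta2]
    rw [← sum2_reflect (fun p q => 1 / ((p : ℝ) ^ (s + 1) * (q : ℝ) ^ 1)),
      ← sum2_reflect (fun p q => 1 / ((p : ℝ) ^ s * (q : ℝ) ^ 2)),
      ← sum2_const_mul (by positivity)]
    have : ∀ i : ℕ, (0 : ℝ) ≤ i + 1 := fun i => by positivity
    simp_rw [← sum2_const_mul (this _)]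
    rw [← sum2_finsetSum, ← sum2_add, ← sum2_add]
    · refine sum2_congr fun p q hq hp => ?_
      have hq0 : (0 : ℝ) < q := by exact_mod_cast hq
      have hm0 : (0 : ℝ) < ((p - q : ℕ) : ℝ) := by exact_mod_cast Nat.sub_pos_of_lt hp
      have := one_div_sq_mul_pow_eq hm0 hq0 s
      have e : ((p - q : ℕ) : ℝ) + q = p := by rw [Nat.cast_sub hp.le]; ring
      rw [e] at this
      simpa using this
    all_goals intros; positivity
  have hsw : sum2 (fun p q => 1 / ((q : ℝ) ^ 2 * (p : ℝ) ^ s)) = eZeta2 s 2 :=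
    sum2_congr fun p q _ _ => by rw [mul_comm]
  have hd : sum1 (fun p => 1 / ((p : ℝ) ^ 2 * (p : ℝ) ^ s)) = eZeta1 (s + 2) :=
    sum1_congr fun p _ => by rw [← pow_add, add_comm]
  rw [hsh, hsw, hd, add_right_comm _ (eZeta2 s 2)] at hst
  -- Both expansions contain `ζ(s, 2)`, which is finite because `s ≥ 2`.
  exact (ENNReal.add_left_inj (eZeta2_ne_top hs (by norm_num))).1 hst

/-! ### Passage to real multiple zeta values. -/

theorem multiZeta_one (a : ℕ) : multiZeta ![a] = (eZeta1 a).toReal := by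
  let e : ℕ ≃ {k : Fin 1 → ℕ // StrictAnti k ∧ ∀ i, 0 < k i} :=
    { toFun := fun x => ⟨![x + 1], Subsingleton.strictAnti _, by simp⟩
      invFun := fun k => k.1 0 - 1
      left_inv := fun x => by simp
      right_inv := fun k => by
        have h0 := k.2.2 0
        ext i
        fin_cases i
        simp
        omega }
  rw [multiZeta, ← e.tsum_eq, eZeta1, sum1, ENNReal.tsum_toReal_eq fun _ => ENNReal.ofReal_ne_top]
  refine tsum_congr fun x => ?_
  rw [ENNReal.toReal_ofReal (by positivity)]
  simp [e]

theorem multiZeta_two (a b : ℕ) : multiZeta ![a, b] = (eZeta2 a b).toReal := by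
  let e : ℕ × ℕ ≃ {k : Fin 2 → ℕ // StrictAnti k ∧ ∀ i, 0 < k i} :=
    { toFun := fun x => ⟨![x.2 + x.1 + 2, x.1 + 1], by
        rw [Fin.strictAnti_iff_succ_lt]; intro i; fin_cases i; simp, by
        intro i; fin_cases i <;> simp⟩
      invFun := fun k => (k.1 1 - 1, k.1 0 - k.1 1 - 1)
      left_inv := fun x => by
        ext
        · simp
        · simp; omega
      right_inv := fun k => by
        have h1 := k.2.2 1
        have h2 := k.2.1 (show (0 : Fin 2) < 1 by decide)
        ext i
        fin_cases i
        · simp; omega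
        · simp; omega }
  rw [multiZeta, ← e.tsum_eq, eZeta2, sum2, ← ENNReal.tsum_prod,
    ENNReal.tsum_toReal_eq fun _ => ENNReal.ofReal_ne_top]
  refine tsum_congr fun x => ?_
  rw [ENNReal.toReal_ofReal (by positivity)]
  simp [e, Fin.prod_univ_succ]

theorem multiZeta_three (a b c : ℕ) : multiZeta ![a, b, c] = (eZeta3 a b c).toReal := by
  let e : ℕ × ℕ × ℕ ≃ {k : Fin 3 → ℕ // StrictAnti k ∧ ∀ i, 0 < k i} :=
    { toFun := fun x => ⟨![x.2.2 + x.2.1 + x.1 + 3, x.2.1 + x.1 + 2, x.1 + 1], by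
        rw [Fin.strictAnti_iff_succ_lt]; intro i; fin_cases i <;> simp, by
        intro i; fin_cases i <;> simp⟩
      invFun := fun k => (k.1 2 - 1, k.1 1 - k.1 2 - 1, k.1 0 - k.1 1 - 1)
      left_inv := fun x => by
        ext
        · simp
        · simp; omega
        · simp; omega
      right_inv := fun k => by
        have h1 := k.2.2 2
        have h2 := k.2.1 (show (0 : Fin 3) < 1 by decide)
        have h3 := k.2.1 (show (1 : Fin 3) < 2 by decide)
        ext i
        fin_cases i
        · simp; omega
        · simp; omega
        · simp; omega }
  have hp : eZeta3 a b c = ∑' x : ℕ × ℕ × ℕ, ENNReal.ofReal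
      (1 / (((x.2.2 + x.2.1 + x.1 + 3 : ℕ) : ℝ) ^ a * ((x.2.1 + x.1 + 2 : ℕ) : ℝ) ^ b *
        ((x.1 + 1 : ℕ) : ℝ) ^ c)) := by
    rw [ENNReal.tsum_prod']
    exact tsum_congr fun z => by rw [ENNReal.tsum_prod']
  rw [multiZeta, ← e.tsum_eq, hp, ENNReal.tsum_toReal_eq fun _ => ENNReal.ofReal_ne_top]
  refine tsum_congr fun x => ?_
  rw [ENNReal.toReal_ofReal (by positivity)]
  simp [e, Fin.prod_univ_succ, mul_assoc]

/-! ### Reindexing and the weighted combination. -/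

/-- Triples `(j, k, l)` with `j ≥ 2`, `k, l ≥ 1` and `j + k + l = n`. -/
def triples (n : ℕ) : Finset (ℕ × ℕ × ℕ) :=
  (Finset.Icc 2 n ×ˢ Finset.Icc 1 n ×ˢ Finset.Icc 1 n).filter
    (fun p : ℕ × ℕ × ℕ => p.1 + p.2.1 + p.2.2 = n)

theorem mem_triples {n : ℕ} {p : ℕ × ℕ × ℕ} :
    p ∈ triples n ↔ 2 ≤ p.1 ∧ 1 ≤ p.2.1 ∧ 1 ≤ p.2.2 ∧ p.1 + p.2.1 + p.2.2 = n := by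
  simp only [triples, Finset.mem_filter, Finset.mem_product, Finset.mem_Icc]
  omega

theorem sum_multiZeta_triples (N : ℕ) :
    ∑ p ∈ triples (N + 4), multiZeta ![p.1, p.2.1, p.2.2] = multiZeta ![N + 4] := by
  simp_rw [multiZeta_three]
  rw [multiZeta_one, ← sum_eZeta3, Finset.sum_sigma', ENNReal.toReal_sum fun a _ =>
    eZeta3_ne_top (by omega) (by omega) (by omega)]
  refine Finset.sum_nbij' (fun p => ⟨(p.1 - 2, p.2.1 + p.2.2 - 2), (p.2.1 - 1, p.2.2 - 1)⟩)
    (fun q => (q.1.1 + 2, q.2.1 + 1, q.2.2 + 1)) ?_ ?_ ?_ ?_ ?_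
  · intro p hp
    rw [mem_triples] at hp
    simp only [Finset.mem_sigma, Finset.HasAntidiagonal.mem_antidiagonal]
    omega
  · rintro ⟨⟨a, s⟩, ⟨b, c⟩⟩ hq
    simp only [Finset.mem_sigma, Finset.HasAntidiagonal.mem_antidiagonal] at hq
    simp only [mem_triples]
    omega
  · rintro ⟨a, b, c⟩ hp
    simp only [mem_triples] at hp
    ext <;> simp <;> omega
  · rintro ⟨⟨a, s⟩, ⟨b, c⟩⟩ hq
    simp only [Finset.mem_sigma, Finset.HasAntidiagonal.mem_antidiagonal] at hq
    obtain ⟨-, rfl⟩ := hq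
    simp
    omega
  · rintro ⟨a, b, c⟩ hp
    simp only [mem_triples] at hp
    congr 2 <;> simp <;> omega

theorem sum_multiZeta_pairs (N : ℕ) :
    ∑ i ∈ Finset.range (N + 2), multiZeta ![i + 2, N + 2 - i] = multiZeta ![N + 4] := by
  simp_rw [multiZeta_two]
  rw [multiZeta_one, ← sum_eZeta2 (N + 1), ENNReal.toReal_sum fun a _ =>
    eZeta2_ne_top (by omega) (by omega),
    Finset.Nat.sum_antidiagonal_eq_sum_range_succ_mk]
  refine Finset.sum_congr rfl fun i hi => ?_
  rw [Finset.mem_range] at hi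
  rw [show N + 1 - i + 1 = N + 2 - i by omega]

theorem weighted_sum_multiZeta_pairs (N : ℕ) :
    ∑ i ∈ Finset.range (N + 2), ((i : ℝ) + 1) * multiZeta ![i + 2, N + 2 - i] =
      multiZeta ![2, N + 2] + multiZeta ![N + 4] - ((N : ℝ) + 2) * multiZeta ![N + 3, 1] := by
  have h := congrArg ENNReal.toReal (shuffle_eq_stuffle (s := N + 2) (by omega))
  have hfin : ∀ i ∈ Finset.range (N + 2),
      ENNReal.ofReal ((i : ℝ) + 1) * eZeta2 (i + 2) (N + 2 - i) ≠ ∞ := fun i hi =>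
    ENNReal.mul_ne_top ENNReal.ofReal_ne_top
      (eZeta2_ne_top (by omega) (by rw [Finset.mem_range] at hi; omega))
  rw [ENNReal.toReal_add (ENNReal.sum_ne_top.2 hfin)
      (ENNReal.mul_ne_top ENNReal.ofReal_ne_top (eZeta2_ne_top (by omega) le_rfl)),
    ENNReal.toReal_add (eZeta2_ne_top le_rfl (by omega)) (eZeta1_ne_top (by omega)),
    ENNReal.toReal_sum hfin, ENNReal.toReal_mul, ENNReal.toReal_ofReal (by positivity)] at h
  simp_rw [ENNReal.toReal_mul] at h
  simp_rw [multiZeta_two, multiZeta_one]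
  rw [eq_sub_iff_add_eq, ← h]
  push_cast
  congr 1
  exact Finset.sum_congr rfl fun i _ => by rw [ENNReal.toReal_ofReal (by positivity)]

theorem multiZeta_hoffman {J : ℕ} (hJ : 1 ≤ J) (K : ℕ) :
    ∑ i ∈ Finset.range J, multiZeta ![i + 2, J - i, K + 1] +
      ∑ i ∈ Finset.range K, multiZeta ![J + 1, i + 2, K - i] =
    multiZeta ![J + 2, K + 1] + multiZeta ![J + 1, K + 2] := by
  have h1 : ∀ i ∈ Finset.range J, eZeta3 (i + 2) (J - i) (K + 1) ≠ ∞ := fun i hi => by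
    rw [Finset.mem_range] at hi
    exact eZeta3_ne_top (by omega) (by omega) (by omega)
  have h2 : ∀ i ∈ Finset.range K, eZeta3 (J + 1) (i + 2) (K - i) ≠ ∞ := fun i hi => by
    rw [Finset.mem_range] at hi
    exact eZeta3_ne_top (by omega) (by omega) (by omega)
  simp_rw [multiZeta_two, multiZeta_three]
  rw [← ENNReal.toReal_sum h1, ← ENNReal.toReal_sum h2,
    ← ENNReal.toReal_add (ENNReal.sum_ne_top.2 h1) (ENNReal.sum_ne_top.2 h2), hoffman_relation hJ,
    ENNReal.toReal_add (eZeta2_ne_top (by omega) (by omega)) (eZeta2_ne_top (by omega) (by omega))]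

/-- In the first sum of Hoffman's relation with `J = j + 1`, the first two arguments add up to `J +
2`, so the multiplier `J + 1` depends on the triple alone. In the second sum it is just the first
argument. -/
theorem sum_range_eq_sum_triples (N : ℕ) (F : ℕ → ℕ → ℕ → ℝ) :
    ∑ j ∈ Finset.range (N + 1), ((j : ℝ) + 2) *
        ∑ i ∈ Finset.range (j + 1), F (i + 2) (j + 1 - i) (N - j + 1) =
      ∑ p ∈ triples (N + 4), ((p.1 : ℝ) + p.2.1 - 1) * F p.1 p.2.1 p.2.2 := by
  simp_rw [Finset.mul_sum]
  rw [Finset.sum_sigma']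
  refine Finset.sum_nbij' (fun q => (q.2 + 2, q.1 + 1 - q.2, N - q.1 + 1))
    (fun p => ⟨p.1 + p.2.1 - 3, p.1 - 2⟩) ?_ ?_ ?_ ?_ ?_
  · rintro ⟨j, i⟩ hq
    simp only [Finset.mem_sigma, Finset.mem_range] at hq
    simp only [mem_triples]
    omega
  · rintro ⟨a, b, c⟩ hp
    simp only [mem_triples] at hp
    simp only [Finset.mem_sigma, Finset.mem_range]
    omega
  · rintro ⟨j, i⟩ hq
    simp only [Finset.mem_sigma, Finset.mem_range] at hq
    simp
    omega
  · rintro ⟨a, b, c⟩ hp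
    simp only [mem_triples] at hp
    ext <;> simp <;> omega
  · rintro ⟨j, i⟩ hq
    simp only [Finset.mem_sigma, Finset.mem_range] at hq
    simp only
    congr 1
    rw [Nat.cast_sub (by omega)]
    push_cast
    ring

theorem sum_range_eq_sum_triples_filter (N : ℕ) (F : ℕ → ℕ → ℕ → ℝ) :
    ∑ j ∈ Finset.range (N + 1), ((j : ℝ) + 2) *
        ∑ i ∈ Finset.range (N - j), F (j + 2) (i + 2) (N - j - i) =
      ∑ p ∈ (triples (N + 4)).filter (fun p => ¬ p.2.1 = 1),
        (p.1 : ℝ) * F p.1 p.2.1 p.2.2 := by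
  simp_rw [Finset.mul_sum]
  rw [Finset.sum_sigma']
  refine Finset.sum_nbij' (fun q => (q.1 + 2, q.2 + 2, N - q.1 - q.2))
    (fun p => ⟨p.1 - 2, p.2.1 - 2⟩) ?_ ?_ ?_ ?_ ?_
  · rintro ⟨j, i⟩ hq
    simp only [Finset.mem_sigma, Finset.mem_range] at hq
    simp only [Finset.mem_filter, mem_triples]
    omega
  · rintro ⟨a, b, c⟩ hp
    simp only [Finset.mem_filter, mem_triples] at hp
    simp only [Finset.mem_sigma, Finset.mem_range]
    omega
  · rintro ⟨j, i⟩ hq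
    simp
  · rintro ⟨a, b, c⟩ hp
    simp only [Finset.mem_filter, mem_triples] at hp
    ext <;> simp <;> omega
  · rintro ⟨j, i⟩ hq
    simp

theorem sum_triples_filter_eq_one (N : ℕ) (F : ℕ → ℕ → ℕ → ℝ) :
    ∑ p ∈ (triples (N + 4)).filter (fun p => p.2.1 = 1), (p.1 : ℝ) * F p.1 p.2.1 p.2.2 =
      ∑ p ∈ (Finset.Icc 2 (N + 4) ×ˢ Finset.Icc 1 (N + 4)).filter
        (fun p : ℕ × ℕ => p.1 + p.2 = N + 4 - 1), (p.1 : ℝ) * F p.1 1 p.2 := by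
  refine Finset.sum_nbij' (fun p => (p.1, p.2.2)) (fun p => (p.1, 1, p.2)) ?_ ?_ ?_ ?_ ?_
  · rintro ⟨a, b, c⟩ hp
    simp only [Finset.mem_filter, mem_triples] at hp
    simp only [Finset.mem_filter, Finset.mem_product, Finset.mem_Icc]
    omega
  · rintro ⟨a, c⟩ hp
    simp only [Finset.mem_filter, Finset.mem_product, Finset.mem_Icc] at hp
    obtain ⟨⟨⟨h1, -⟩, h2, -⟩, h3⟩ := hp
    simp only [Finset.mem_filter, mem_triples]
    refine ⟨⟨h1, le_rfl, h2, ?_⟩, trivial⟩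
    omega
  · rintro ⟨a, b, c⟩ hp
    simp only [Finset.mem_filter] at hp
    simp [hp.2]
  · rintro ⟨a, c⟩ hp
    rfl
  · rintro ⟨a, b, c⟩ hp
    simp only [Finset.mem_filter] at hp
    simp [hp.2]

theorem sum_triples_sub_eq (N : ℕ) :
    (∑ p ∈ triples (N + 4), (2 * (p.1 : ℝ) + p.2.1) * multiZeta ![p.1, p.2.1, p.2.2]) -
      (∑ p ∈ (Finset.Icc 2 (N + 4) ×ˢ Finset.Icc 1 (N + 4)).filter
        (fun p : ℕ × ℕ => p.1 + p.2 = N + 4 - 1), (p.1 : ℝ) * multiZeta ![p.1, 1, p.2]) =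
    multiZeta ![2, N + 2] + 4 * multiZeta ![N + 4] -
      (3 * (N : ℝ) + 7) * multiZeta ![N + 3, 1] := by
  -- Hoffman's relation with `J = j + 1`, `K = N - j`, multiplied by `J + 1` and summed over `j`.
  have hH : ∑ j ∈ Finset.range (N + 1), ((j : ℝ) + 2) *
        ∑ i ∈ Finset.range (j + 1), multiZeta ![i + 2, j + 1 - i, N - j + 1] +
      ∑ j ∈ Finset.range (N + 1), ((j : ℝ) + 2) *
        ∑ i ∈ Finset.range (N - j), multiZeta ![j + 2, i + 2, N - j - i] =
      ∑ j ∈ Finset.range (N + 1), ((j : ℝ) + 2) * multiZeta ![j + 3, N + 1 - j] +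
      ∑ j ∈ Finset.range (N + 1), ((j : ℝ) + 2) * multiZeta ![j + 2, N + 2 - j] := by
    rw [← Finset.sum_add_distrib, ← Finset.sum_add_distrib]
    refine Finset.sum_congr rfl fun j hj => ?_
    rw [Finset.mem_range] at hj
    rw [← mul_add, ← mul_add, show N + 1 - j = N - j + 1 by omega,
      show N + 2 - j = N - j + 2 by omega]
    exact congrArg _ (multiZeta_hoffman (J := j + 1) (by omega) (N - j))
  rw [sum_range_eq_sum_triples N fun a b c => multiZeta ![a, b, c],
    sum_range_eq_sum_triples_filter N fun a b c => multiZeta ![a, b, c]] at hH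
  rw [← sum_triples_filter_eq_one N fun a b c => multiZeta ![a, b, c]]
  have hsplit := Finset.sum_filter_add_sum_filter_not (triples (N + 4)) (fun p => p.2.1 = 1)
    (fun p => (p.1 : ℝ) * multiZeta ![p.1, p.2.1, p.2.2])
  have hL : ∑ p ∈ triples (N + 4), (2 * (p.1 : ℝ) + p.2.1) * multiZeta ![p.1, p.2.1, p.2.2] =
      ∑ p ∈ triples (N + 4), ((p.1 : ℝ) + p.2.1 - 1) * multiZeta ![p.1, p.2.1, p.2.2] +
      ∑ p ∈ triples (N + 4), multiZeta ![p.1, p.2.1, p.2.2] +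
      ∑ p ∈ triples (N + 4), (p.1 : ℝ) * multiZeta ![p.1, p.2.1, p.2.2] := by
    rw [← Finset.sum_add_distrib, ← Finset.sum_add_distrib]
    exact Finset.sum_congr rfl fun p _ => by ring
  have hW := weighted_sum_multiZeta_pairs N
  have hS := sum_multiZeta_pairs N
  -- After a shift of the index this is the weighted sum in `hW` without its term `ζ(2, N+2)`; in
  -- `hG` the weight exceeds that of `hW` by one and the last term `ζ(N+3, 1)` is absent.
  have hF : ∑ j ∈ Finset.range (N + 1), ((j : ℝ) + 2) * multiZeta ![j + 3, N + 1 - j] =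
      ∑ i ∈ Finset.range (N + 2), ((i : ℝ) + 1) * multiZeta ![i + 2, N + 2 - i] -
        multiZeta ![2, N + 2] := by
    rw [Finset.sum_range_succ' _ (N + 1)]
    simp only [Nat.cast_zero, zero_add, one_mul, Nat.sub_zero, add_sub_cancel_right]
    refine Finset.sum_congr rfl fun j _ => ?_
    rw [show N + 2 - (j + 1) = N + 1 - j by omega, show j + 1 + 2 = j + 3 by omega]
    push_cast
    ring
  have hG : ∑ j ∈ Finset.range (N + 1), ((j : ℝ) + 2) * multiZeta ![j + 2, N + 2 - j] =
      ∑ i ∈ Finset.range (N + 2), ((i : ℝ) + 1) * multiZeta ![i + 2, N + 2 - i] +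
        ∑ i ∈ Finset.range (N + 2), multiZeta ![i + 2, N + 2 - i] -
        ((N : ℝ) + 3) * multiZeta ![N + 3, 1] := by
    rw [← Finset.sum_add_distrib, Finset.sum_range_succ _ (N + 1),
      show N + 2 - (N + 1) = 1 by omega, show N + 1 + 2 = N + 3 by omega]
    have : ∀ j : ℕ, ((j : ℝ) + 1) * multiZeta ![j + 2, N + 2 - j] +
      multiZeta ![j + 2, N + 2 - j] = ((j : ℝ) + 2) * multiZeta ![j + 2, N + 2 - j] :=
      fun j => by ring
    simp_rw [this]
    push_cast
    ring
  rw [hF, hG, hW, hS] at hH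
  rw [hL, sum_multiZeta_triples, ← hsplit]
  linear_combination hH

theorem mainTheorem4 (n : ℕ) (hn : 4 ≤ n) :
    (∑ p ∈ (Finset.Icc 2 n ×ˢ Finset.Icc 1 n ×ˢ Finset.Icc 1 n).filter
        (fun p : ℕ × ℕ × ℕ => p.1 + p.2.1 + p.2.2 = n),
        (2 * (p.1 : ℝ) + (p.2.1 : ℝ)) * multiZeta ![p.1, p.2.1, p.2.2]) -
      (∑ p ∈ (Finset.Icc 2 n ×ˢ Finset.Icc 1 n).filter
        (fun p : ℕ × ℕ => p.1 + p.2 = n - 1),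
        (p.1 : ℝ) * multiZeta ![p.1, 1, p.2]) =
    multiZeta ![2, n - 2] + 4 * multiZeta ![n] -
      (3 * (n : ℝ) - 5) * multiZeta ![n - 1, 1] := by
  obtain ⟨N, rfl⟩ := Nat.exists_eq_add_of_le' hn
  have h := sum_triples_sub_eq N
  rw [triples] at h
  rw [h, show N + 4 - 2 = N + 2 by omega, show N + 4 - 1 = N + 3 by omega]
  push_cast
  ring
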